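/- **Theorem 1.1 (Darboux).** Let $M$ be a smooth manifold of dimension $2n$ (without boundary) and let $\omega$ be a symplectic form on $M$, i.e. a smooth $2$-form with $d\omega=0$ such that for every nonzero tangent vector $v\in T_xM$ there is $w\in T_xM$ with $\omega_x(v,w)\neq 0$. Let $x_1,\dots,x_n,y_1,\dots,y_n$ be the standard coordinates on $\mathbb{R}^{2n}$ and let $\omega_0=\sum_{i=1}^n dx_i\wedge dy_i$. Then for every point $p\in M$ there exist an open neighborhood $U$ of $p$ in $M$, an open neighborhood $V$ of $0$ in $\mathbb{R}^{2n}$, and a symplectomorphism $\varphi:(U,\omega|_U)\to(V,\omega_0|_V)$ with $\varphi(p)=0$, i.e. a $C^\infty$ diffeomorphism $\varphi:U\to V$ with $\varphi(p)=0$ and $\varphi^*\omega_0=\omega$ on $U$. -/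

import Mathlib

open scoped Manifold ContDiff

namespace Symplectic

noncomputable section

section Forms

variable {E : Type*} [NormedAddCommGroup E] [NormedSpace ℝ E]
  {M : Type*} [TopologicalSpace M] [ChartedSpace E M]
  {F : Type*} [NormedAddCommGroup F] [NormedSpace ℝ F]
  {N : Type*} [TopologicalSpace N] [ChartedSpace F N]

/-- A (not necessarily smooth) differential `k`-form on a manifold `M` modelled on `E`:
a choice of an alternating `k`-linear form on each tangent space. -/
abbrev FormField (E : Type*) [NormedAddCommGroup E] [NormedSpace ℝ E]
    (M : Type*) [TopologicalSpace M] [ChartedSpace E M] (k : ℕ) : Type _ :=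
  ∀ x : M, (TangentSpace 𝓘(ℝ, E) x) [⋀^Fin k]→L[ℝ] ℝ

/-- The pullback `f^* σ`, i.e. `(f^* σ)_x (v₁, …, v_k) = σ_{f x} (df_x v₁, …, df_x v_k)`. -/
def FormField.pullback {k : ℕ} (f : M → N) (σ : FormField F N k) : FormField E M k :=
  fun x => (σ (f x)).compContinuousLinearMap (mfderiv 𝓘(ℝ, E) 𝓘(ℝ, F) f x)

/-- The expression `(e⁻¹)^* σ` of the form `σ` in the chart `e`, as a form on the model space.
It is meaningful on the open set `e.target`. -/
def FormField.inChart {k : ℕ} (σ : FormField E M k) (e : OpenPartialHomeomorph M E) :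
    E → E [⋀^Fin k]→L[ℝ] ℝ :=
  FormField.pullback (E := E) (M := E) e.symm σ

/-- `σ` is smooth: its expression in every chart of the atlas is smooth. -/
def FormField.IsSmooth {k : ℕ} (σ : FormField E M k) : Prop :=
  ∀ e ∈ atlas E M, ContDiffOn ℝ ∞ (σ.inChart e) e.target

/-- `dσ = 0`: the exterior derivative of `σ`, computed in every chart of the atlas, vanishes. -/
def FormField.IsClosed {k : ℕ} (σ : FormField E M k) : Prop :=
  ∀ e ∈ atlas E M, ∀ y ∈ e.target, extDeriv (σ.inChart e) y = 0

/-- `ι_v σ ≠ 0` for every nonzero tangent vector `v`. -/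
def FormField.IsNondegenerate (σ : FormField E M 2) : Prop :=
  ∀ (x : M) (v : TangentSpace 𝓘(ℝ, E) x), v ≠ 0 →
    ∃ w : TangentSpace 𝓘(ℝ, E) x, σ x ![v, w] ≠ 0

/-- A symplectic structure: a smooth closed non-degenerate 2-form. -/
structure IsSymplecticForm (σ : FormField E M 2) : Prop where
  smooth : σ.IsSmooth
  closed : σ.IsClosed
  nondegenerate : σ.IsNondegenerate

/-- `φ` is a symplectomorphism from the open subset `φ.source` of `(M, σ)` onto the open subset
`φ.target` of `(N, τ)`: a homeomorphism between these open sets, smooth in both directions,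
with `φ^* τ = σ` on `φ.source`. -/
structure IsSymplectomorphism (σ : FormField E M 2) (τ : FormField F N 2)
    (φ : OpenPartialHomeomorph M N) : Prop where
  smooth : ContMDiffOn 𝓘(ℝ, E) 𝓘(ℝ, F) ∞ φ φ.source
  smooth_symm : ContMDiffOn 𝓘(ℝ, F) 𝓘(ℝ, E) ∞ φ.symm φ.target
  pullback_eq : ∀ x ∈ φ.source, FormField.pullback (E := E) (M := M) φ τ x = σ x

end Forms

/-- The wedge product of two linear forms:
`(α ∧ β) (v, w) = α v * β w - α w * β v`. -/
def wedge {E : Type*} [NormedAddCommGroup E] [NormedSpace ℝ E] (α β : E →L[ℝ] ℝ) :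
    E [⋀^Fin 2]→L[ℝ] ℝ where
  toFun v := α (v 0) * β (v 1) - α (v 1) * β (v 0)
  map_update_add' := by
    intro _ m i x y
    fin_cases i <;> simp [Function.update] <;> ring
  map_update_smul' := by
    intro _ m i c x
    fin_cases i <;> simp [Function.update] <;> ring
  map_eq_zero_of_eq' := by
    intro v i j h hij
    fin_cases i <;> fin_cases j <;> simp_all
  cont := by fun_prop

/-- The linear coordinate `x_i` on `ℝ²ⁿ` with coordinates `(x₁, …, xₙ, y₁, …, yₙ)`;
being linear, it is its own differential `dx_i` at each point. -/
def dx {n : ℕ} (i : Fin n) : EuclideanSpace ℝ (Fin (2 * n)) →L[ℝ] ℝ :=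
  EuclideanSpace.proj (⟨i, by omega⟩ : Fin (2 * n))

/-- The linear coordinate `y_i` on `ℝ²ⁿ` with coordinates `(x₁, …, xₙ, y₁, …, yₙ)`;
being linear, it is its own differential `dy_i` at each point. -/
def dy {n : ℕ} (i : Fin n) : EuclideanSpace ℝ (Fin (2 * n)) →L[ℝ] ℝ :=
  EuclideanSpace.proj (⟨n + i, by omega⟩ : Fin (2 * n))

/-- The standard form `ω₀ = ∑ dx_i ∧ dy_i` on `ℝ²ⁿ`. -/
def standardForm (n : ℕ) :
    FormField (EuclideanSpace ℝ (Fin (2 * n))) (EuclideanSpace ℝ (Fin (2 * n))) 2 :=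
  fun _ => (∑ i : Fin n, wedge (dx i) (dy i) :
    (EuclideanSpace ℝ (Fin (2 * n))) [⋀^Fin 2]→L[ℝ] ℝ)

end

end Symplectic

set_option maxSynthPendingDepth 3

open Set Filter Topology

/-! ### Differential calculus on spaces of continuous curves -/

namespace ContinuousMap

section Postcomposition

variable {K : Type*} [TopologicalSpace K] [CompactSpace K]

/-! Moser's deformation argument. In a chart centred at `p` the form becomes a field `b` of skew
bilinear forms. By the Poincaré lemma (`exists_primitive_of_closed`), `b - b 0 = dα` near `0`. Put
`Ω_t = b 0 + t (b - b 0)` and solve `Ω_t(X_t, ·) = -α`. Since `d(ι_X Ω_t) + (b - b 0) = 0`, the flow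
of `X` preserves `Ω_t`, so its time-one map pulls `b` back to the constant form `b 0`
(`exists_pullback_eq_const`). A symplectic basis of `b 0` then gives the standard form.

The flow is built by the inverse function theorem in the Banach space of curves on `[0,1]`.
Postcomposition with a smooth map is smooth there (`contDiff_comp`), so the integral equation is
smooth in the curve. As `b - b 0` vanishes at `0`, both `α` and `dα` do, hence `X` vanishes to
second order along `[0,1] × {0}`. The linearised integral equation at the zero curve is therefore
the identity, and solutions near it exist up to time one and depend smoothly on the initial point.
Differentiating the equation gives the variational equation (`exists_flow_with_variation`). -/

theorem eventually_dist_comp_add_le {E G : Type*} [NormedAddCommGroup E] [PseudoMetricSpace G]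
    (g : C(E, G)) (γ : C(K, E)) {c : ℝ} (hc : 0 < c) : ∀ᶠ η : C(K, E) in 𝓝 0, dist (g.comp (γ + η)) (g.comp γ) ≤ c := by
  have h : Continuous (fun η : C(K, E) => g.comp (γ + η)) :=
    (continuous_postcomp g).comp (continuous_const.add continuous_id)
  have h0 : Tendsto (fun η : C(K, E) => g.comp (γ + η)) (𝓝 0) (𝓝 (g.comp γ)) := by
    simpa using h.tendsto 0
  exact (h0.eventually (Metric.ball_mem_nhds _ hc)).mono fun _ h => (Metric.mem_ball.1 h).le

/-- Pointwise evaluation of a continuous family of continuous linear maps on a continuous family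
of vectors, as a bounded bilinear map. -/
noncomputable def pointwiseApplyL (K : Type*) [TopologicalSpace K] [CompactSpace K]
    (E F : Type*) [NormedAddCommGroup E] [NormedSpace ℝ E]
    [NormedAddCommGroup F] [NormedSpace ℝ F] : C(K, E →L[ℝ] F) →L[ℝ] C(K, E) →L[ℝ] C(K, F) :=
  LinearMap.mkContinuous₂
    (LinearMap.mk₂ ℝ (fun (c : C(K, E →L[ℝ] F)) (h : C(K, E)) =>
        (⟨fun t => c t (h t), c.continuous.clm_apply h.continuous⟩ : C(K, F)))
      (fun _ _ _ => by ext; simp) (fun _ _ _ => by ext; simp)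
      (fun _ _ _ => by ext; simp) (fun _ _ _ => by ext; simp))
    1 (fun c h => by
      rw [ContinuousMap.norm_le _ (by positivity)]
      intro t
      rw [one_mul]
      exact (c t).le_of_opNorm_le_of_le (c.norm_coe_le_norm t) (h.norm_coe_le_norm t))

variable {E F : Type*} [NormedAddCommGroup E] [NormedSpace ℝ E]
    [NormedAddCommGroup F] [NormedSpace ℝ F]

@[simp] theorem pointwiseApplyL_apply (c : C(K, E →L[ℝ] F)) (h : C(K, E)) (t : K) :
    pointwiseApplyL K E F c h t = c t (h t) := rfl

/-- The mean value inequality at each `t` bounds the remainder. The bound is uniform in `t` because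
`K` is compact: postcomposition with `f'` is continuous in the sup norm. -/
theorem hasFDerivAt_comp (f : C(E, F)) (f' : C(E, E →L[ℝ] F))
    (hf : ∀ x, HasFDerivAt f (f' x) x) (γ : C(K, E)) :
    HasFDerivAt (fun γ : C(K, E) => f.comp γ) (pointwiseApplyL K E F (f'.comp γ)) γ := by
  rw [hasFDerivAt_iff_isLittleO_nhds_zero, Asymptotics.isLittleO_iff]
  intro c hc
  have hcont := eventually_dist_comp_add_le f' γ hc
  obtain ⟨δ, hδ, hball⟩ := Metric.eventually_nhds_iff_ball.1 hcont
  filter_upwards [Metric.ball_mem_nhds _ hδ] with η hη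
  rw [ContinuousMap.norm_le _ (by positivity)]
  intro t
  have hseg : ∀ y ∈ segment ℝ (γ t) (γ t + η t), ‖f' y - f' (γ t)‖ ≤ c := by
    rintro y hy
    rw [segment_eq_image'] at hy
    obtain ⟨s, hs, rfl⟩ := hy
    -- A point of the segment at one `t` is the value there of the curve `γ + s • η`, to which the
    -- uniform estimate applies.
    have hsη : s • η ∈ Metric.ball (0 : C(K, E)) δ := by
      rw [mem_ball_zero_iff] at hη ⊢
      rw [norm_smul, Real.norm_of_nonneg hs.1]
      exact (mul_le_of_le_one_left (norm_nonneg _) hs.2).trans_lt hη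
    have := (ContinuousMap.dist_apply_le_dist t).trans (hball _ hsη)
    simpa [dist_eq_norm] using this
  have := Convex.norm_image_sub_le_of_norm_hasFDerivWithin_le'
    (fun y _ => (hf y).hasFDerivWithinAt) hseg (convex_segment _ _)
    (left_mem_segment ℝ _ _) (right_mem_segment ℝ _ _)
  simp only [add_sub_cancel_left] at this
  exact this.trans (mul_le_mul_of_nonneg_left (η.norm_coe_le_norm t) hc.le)

end Postcomposition

section

universe u
variable {K : Type*} [TopologicalSpace K] [CompactSpace K]
  {E : Type u} [NormedAddCommGroup E] [NormedSpace ℝ E]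

/-- The derivative of postcomposition by `f` is postcomposition by `fderiv ℝ f` followed by a
bounded linear map. The induction thus changes the codomain, so `F` is quantified inside it. -/
theorem contDiff_nat_comp (n : ℕ) :
    ∀ {F : Type u} [NormedAddCommGroup F] [NormedSpace ℝ F] (f : C(E, F)),
      ContDiff ℝ n f → ContDiff ℝ n (fun γ : C(K, E) => f.comp γ) := by
  induction n with
  | zero =>
    intro F _ _ f _
    exact contDiff_zero.2 (continuous_postcomp f)
  | succ n ih =>
    intro F _ _ f hf
    have hf' : ContDiff ℝ n (fderiv ℝ f) := (contDiff_succ_iff_fderiv.1 (by exact_mod_cast hf)).2.2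
    have hd (γ : C(K, E)) := hasFDerivAt_comp f ⟨fderiv ℝ f, hf'.continuous⟩
      (fun x => (hf.differentiable (by simp) x).hasFDerivAt) γ
    push_cast
    rw [contDiff_succ_iff_fderiv]
    refine ⟨fun γ => (hd γ).differentiableAt, by simp, ?_⟩
    rw [funext fun γ => (hd γ).fderiv]
    exact (pointwiseApplyL K E F).contDiff.comp (ih ⟨fderiv ℝ f, hf'.continuous⟩ hf')

theorem contDiff_comp {F : Type u} [NormedAddCommGroup F] [NormedSpace ℝ F]
    (f : C(E, F)) (hf : ContDiff ℝ ∞ f) :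
    ContDiff ℝ ∞ (fun γ : C(K, E) => f.comp γ) :=
  contDiff_infty.2 fun n => contDiff_nat_comp n f (contDiff_infty.1 hf n)

end

section Primitive

variable {E : Type*} [NormedAddCommGroup E]

/-- The extension of a continuous map on the unit interval, constant on both sides. -/
noncomputable def extendUnit (c : C(unitInterval, E)) : C(ℝ, E) := c.IccExtend zero_le_one

theorem extendUnit_of_mem (c : C(unitInterval, E)) {t : ℝ} (ht : t ∈ unitInterval) :
    c.extendUnit t = c ⟨t, ht⟩ := by
  simp [extendUnit, ContinuousMap.IccExtend, Set.IccExtend_of_mem zero_le_one _ ht]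

theorem norm_extendUnit_le (c : C(unitInterval, E)) (t : ℝ) : ‖c.extendUnit t‖ ≤ ‖c‖ :=
  c.norm_coe_le_norm _

variable [NormedSpace ℝ E]

/-- The operator sending `c` to its primitive `t ↦ ∫ s in 0..t, c s`. -/
noncomputable def primitiveL (E : Type*) [NormedAddCommGroup E] [NormedSpace ℝ E] :
    C(unitInterval, E) →L[ℝ] C(unitInterval, E) :=
  LinearMap.mkContinuous
    { toFun := fun c => ⟨fun t => ∫ s in (0 : ℝ)..t, c.extendUnit s,
        (intervalIntegral.continuous_primitive
          (fun a b => c.extendUnit.continuous.intervalIntegrable a b) 0).comp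
          continuous_subtype_val⟩
      map_add' := fun c d => by
        ext t
        exact intervalIntegral.integral_add (c.extendUnit.continuous.intervalIntegrable _ _)
          (d.extendUnit.continuous.intervalIntegrable _ _)
      map_smul' := fun r c => by
        ext t
        exact intervalIntegral.integral_smul r _ }
    1 (fun c => by
      rw [ContinuousMap.norm_le _ (by positivity)]
      intro t
      refine (intervalIntegral.norm_integral_le_of_norm_le_const (C := ‖c‖)
        fun s _ => c.norm_extendUnit_le s).trans ?_
      rw [one_mul, sub_zero, abs_of_nonneg t.2.1]
      exact mul_le_of_le_one_right (norm_nonneg _) t.2.2)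

theorem primitiveL_apply (c : C(unitInterval, E)) (t : unitInterval) :
    primitiveL E c t = ∫ s in (0 : ℝ)..t, c.extendUnit s := rfl

end Primitive

end ContinuousMap

/-! ### Cutoffs, and flows by the inverse function theorem -/

theorem exists_contDiff_eventuallyEq_nhdsSet {E F : Type*} [NormedAddCommGroup E] [NormedSpace ℝ E]
    [FiniteDimensional ℝ E] [NormedAddCommGroup F] [NormedSpace ℝ F] {f : E → F} {W K : Set E}
    (hW : IsOpen W) (hf : ContDiffOn ℝ ∞ f W) (hK : IsCompact K) (hKW : K ⊆ W) :
    ∃ g : E → F, ContDiff ℝ ∞ g ∧ g =ᶠ[𝓝ˢ K] f := by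
  obtain ⟨L, hL, hKL, hLW⟩ := exists_compact_between hK hW hKW
  obtain ⟨χ, h1, h0, -⟩ := exists_contMDiffMap_one_nhds_of_subset_interior (n := ⊤) 𝓘(ℝ, E)
    hK.isClosed hKL
  have hχ : ContDiff ℝ ∞ χ := χ.contMDiff.contDiff
  refine ⟨fun x => χ x • f x, contDiff_iff_contDiffAt.2 fun x => ?_, h1.mono fun x hx => by simp [hx]⟩
  by_cases hx : x ∈ W
  · exact hχ.contDiffAt.smul (hf.contDiffAt (hW.mem_nhds hx))
  · have : (fun x => χ x • f x) =ᶠ[𝓝 x] fun _ => 0 := by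
      filter_upwards [hL.isClosed.isOpen_compl.mem_nhds fun h => hx (hLW h)] with y hy
      simp [h0 y hy]
    exact contDiffAt_const.congr_of_eventuallyEq this

section Flow

universe u
variable {E : Type u} [NormedAddCommGroup E] [NormedSpace ℝ E]

/-- The curve `t ↦ (t, γ t)` in space-time attached to the curve `γ`. -/
noncomputable def ContinuousMap.graphCurve (γ : C(unitInterval, E)) : C(unitInterval, ℝ × E) :=
  (⟨fun t => (t, 0), by fun_prop⟩ : C(unitInterval, ℝ × E)) +
    (ContinuousLinearMap.inr ℝ ℝ E).compLeftContinuous ℝ unitInterval γ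

@[simp] theorem ContinuousMap.graphCurve_apply (γ : C(unitInterval, E)) (t : unitInterval) :
    γ.graphCurve t = ((t : ℝ), γ t) := by
  simp [ContinuousMap.graphCurve]

theorem ContinuousMap.contDiff_graphCurve {n : WithTop ℕ∞} :
    ContDiff ℝ n (ContinuousMap.graphCurve (E := E)) :=
  contDiff_const.add
    ((ContinuousLinearMap.inr ℝ ℝ E).compLeftContinuous ℝ unitInterval).contDiff

theorem ContinuousMap.hasFDerivAt_graphCurve (γ : C(unitInterval, E)) :
    HasFDerivAt (ContinuousMap.graphCurve (E := E))
      ((ContinuousLinearMap.inr ℝ ℝ E).compLeftContinuous ℝ unitInterval) γ :=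
  (ContinuousLinearMap.hasFDerivAt _).const_add _

/-- Invertible operators form an open set, so the derivative of `f` remains invertible near `a` and
the inverse is smooth at all nearby points, not only at `f a`. -/
theorem ContDiff.eventually_contDiffAt_localInverse {V : Type*} [NormedAddCommGroup V]
    [NormedSpace ℝ V] [CompleteSpace V] {f : V → V} {f' : V ≃L[ℝ] V} {a : V} {n : WithTop ℕ∞}
    (hf : ContDiff ℝ n f) (hf' : HasFDerivAt f (f' : V →L[ℝ] V) a) (hn : n ≠ 0) :
    ∀ᶠ y in 𝓝 (f a), ContDiffAt ℝ n (hf.contDiffAt.localInverse hf' hn) y := by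
  set Φ := hf.contDiffAt.toOpenPartialHomeomorph f hf' hn
  have ha : a ∈ Φ.source := hf.contDiffAt.mem_toOpenPartialHomeomorph_source hf' hn
  have hΦ : (Φ : V → V) = f := hf.contDiffAt.toOpenPartialHomeomorph_coe hf' hn
  have hopen : IsOpen {x | fderiv ℝ f x ∈ range ((↑) : (V ≃L[ℝ] V) → V →L[ℝ] V)} :=
    ContinuousLinearEquiv.isOpen.preimage (hf.continuous_fderiv hn)
  have hsymm : Tendsto Φ.symm (𝓝 (f a)) (𝓝 a) := by
    have := Φ.tendsto_symm ha
    rwa [hΦ] at this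
  have htarget : f a ∈ Φ.target := hΦ ▸ Φ.map_source ha
  filter_upwards [Φ.open_target.mem_nhds htarget,
    hsymm.eventually (hopen.mem_nhds ⟨f', hf'.fderiv.symm⟩)] with y hy hy'
  obtain ⟨L, hL⟩ := hy'
  refine Φ.contDiffAt_symm (f₀' := L) hy ?_ ?_
  · rw [hL, hΦ]
    exact (hf.differentiable hn _).hasFDerivAt
  · rw [hΦ]
    exact hf.contDiffAt

/-- Smooth dependence on the initial value, up to time `1`, for a time-dependent vector field
which vanishes to second order at the origin. -/
theorem exists_contDiffAt_integralCurve [CompleteSpace E] {X : ℝ × E → E} (hX : ContDiff ℝ ∞ X)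
    (h0 : ∀ t ∈ unitInterval, X (t, 0) = 0)
    (h1 : ∀ t ∈ unitInterval, fderiv ℝ X (t, 0) = 0) :
    ∃ γ : E → C(unitInterval, E), (∀ᶠ x in 𝓝 0, ContDiffAt ℝ ∞ γ x) ∧ γ 0 = 0 ∧
      ∀ᶠ x in 𝓝 0, γ x = ContinuousMap.const _ x + ContinuousMap.primitiveL E
        ((⟨X, hX.continuous⟩ : C(ℝ × E, E)).comp (γ x).graphCurve) := by
  set f : C(ℝ × E, E) := ⟨X, hX.continuous⟩
  -- The equation `Ψ γ = const x` is the integral equation of the flow with initial value `x`, so a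
  -- local inverse of `Ψ` evaluated on constants is the solution map.
  let Ψ : C(unitInterval, E) → C(unitInterval, E) := fun γ =>
    γ - ContinuousMap.primitiveL E (f.comp γ.graphCurve)
  have hΨ : ContDiff ℝ ∞ Ψ := contDiff_id.sub ((ContinuousMap.primitiveL E).contDiff.comp
    ((ContinuousMap.contDiff_comp f hX).comp ContinuousMap.contDiff_graphCurve))
  have hΨ0 : Ψ 0 = 0 := by
    have : f.comp (0 : C(unitInterval, E)).graphCurve = 0 := by
      ext t; simpa [f] using h0 t t.2
    simp [Ψ, this]
  have hd : HasFDerivAt Ψ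
      ((ContinuousLinearEquiv.refl ℝ C(unitInterval, E) :
        C(unitInterval, E) →L[ℝ] C(unitInterval, E))) 0 := by
    have hf' : Continuous (fderiv ℝ X) := hX.continuous_fderiv (by simp)
    have h := (hasFDerivAt_id (𝕜 := ℝ) (0 : C(unitInterval, E))).sub
      ((ContinuousMap.primitiveL E).hasFDerivAt.comp 0
      ((ContinuousMap.hasFDerivAt_comp f ⟨fderiv ℝ X, hf'⟩
        (fun x => (hX.differentiable (by simp) x).hasFDerivAt) _).comp 0
        (ContinuousMap.hasFDerivAt_graphCurve 0)))
    have hz : (⟨fderiv ℝ X, hf'⟩ : C(ℝ × E, ℝ × E →L[ℝ] E)).comp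
        (0 : C(unitInterval, E)).graphCurve = 0 := by
      ext1 t; simpa using h1 t t.2
    rw [hz] at h
    refine h.congr_fderiv ?_
    ext1 c
    simp
  have hn : (∞ : WithTop ℕ∞) ≠ 0 := by simp
  have hloc := hΨ.eventually_contDiffAt_localInverse hd hn
  rw [hΨ0] at hloc
  have hconst : ContDiff ℝ ∞ (fun x : E => ContinuousMap.const unitInterval x) :=
    (ContinuousLinearMap.const ℝ unitInterval (M := E)).contDiff
  have hc0 : ContinuousMap.const unitInterval (0 : E) = 0 := rfl
  have ht : Tendsto (fun x : E => ContinuousMap.const unitInterval x) (𝓝 0) (𝓝 0) :=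
    hconst.continuous.tendsto' 0 0 hc0
  refine ⟨fun x => hΨ.contDiffAt.localInverse hd hn (ContinuousMap.const _ x), ?_, ?_, ?_⟩
  · filter_upwards [ht.eventually hloc] with x hx
    exact hx.comp x hconst.contDiffAt
  · have h := hΨ.contDiffAt.localInverse_apply_image hd hn
    rwa [hΨ0] at h
  · have hev := (hΨ.contDiffAt.hasStrictFDerivAt' hd hn).eventually_right_inverse
    rw [hΨ0] at hev
    filter_upwards [ht.eventually hev] with x hx
    exact sub_eq_iff_eq_add.1 hx

end Flow

section IntegralCurve

universe u
variable {E : Type u} [NormedAddCommGroup E] [NormedSpace ℝ E]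

theorem ContinuousMap.hasDerivWithinAt_extendUnit_of_eq_primitive [CompleteSpace E]
    {γ c : C(unitInterval, E)} {x : E}
    (h : γ = ContinuousMap.const _ x + ContinuousMap.primitiveL E c) {t : ℝ}
    (ht : t ∈ unitInterval) :
    HasDerivWithinAt γ.extendUnit (c ⟨t, ht⟩) unitInterval t := by
  have h1 : HasDerivAt (fun t => x + ∫ s in (0 : ℝ)..t, c.extendUnit s) (c.extendUnit t) t :=
    (intervalIntegral.integral_hasDerivAt_right (c.extendUnit.continuous.intervalIntegrable _ _)
      (c.extendUnit.continuous.stronglyMeasurableAtFilter _ _)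
      c.extendUnit.continuous.continuousAt).const_add x
  rw [extendUnit_of_mem _ ht] at h1
  refine h1.hasDerivWithinAt.congr_of_mem (fun s hs => ?_) ht
  rw [extendUnit_of_mem _ hs, h]
  rfl

/-- The flow up to time `1` of a time-dependent vector field which vanishes to second order at the
origin, together with the variational equation satisfied by its space derivative. -/
theorem exists_flow_with_variation [CompleteSpace E] {X : ℝ × E → E} (hX : ContDiff ℝ ∞ X)
    (h0 : ∀ t ∈ unitInterval, X (t, 0) = 0)
    (h1 : ∀ t ∈ unitInterval, fderiv ℝ X (t, 0) = 0) {W : Set (ℝ × E)}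
    (hW : W ∈ 𝓝ˢ (unitInterval ×ˢ {(0 : E)})) :
    ∃ ψ : E → E, (∀ᶠ x in 𝓝 0, ContDiffAt ℝ ∞ ψ x) ∧ ψ 0 = 0 ∧
      ∀ᶠ x in 𝓝 0, ∃ (γ : ℝ → E) (A : ℝ → E → E),
      γ 1 = ψ x ∧ (∀ u, A 0 u = u) ∧ (∀ u, A 1 u = fderiv ℝ ψ x u) ∧
      ∀ t ∈ unitInterval, (t, γ t) ∈ W ∧
        HasDerivWithinAt γ (X (t, γ t)) unitInterval t ∧
        ∀ u, HasDerivWithinAt (fun s => A s u) (fderiv ℝ X (t, γ t) (0, A t u)) unitInterval t := by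
  obtain ⟨γ, hγ, hγ0, hev⟩ := exists_contDiffAt_integralCurve hX h0 h1
  set f : C(ℝ × E, E) := ⟨X, hX.continuous⟩
  have hf' : Continuous (fderiv ℝ X) := hX.continuous_fderiv (by simp)
  set f' : C(ℝ × E, ℝ × E →L[ℝ] E) := ⟨fderiv ℝ X, hf'⟩
  have hdiff : ∀ᶠ x in 𝓝 0, DifferentiableAt ℝ γ x :=
    hγ.mono fun x hx => hx.differentiableAt (by simp)
  -- Curves mapping the compact interval into an open set form an open set, which controls all times
  -- at once.
  have hWev : ∀ᶠ x in 𝓝 0, ∀ t, (γ x).graphCurve t ∈ W := by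
    obtain ⟨O, hO, hKO, hOW⟩ := mem_nhdsSet_iff_exists.1 hW
    have hopen := ContinuousMap.isOpen_setOfPred_mapsTo (X := unitInterval) (Y := ℝ × E)
      isCompact_univ hO
    have hcont : ContinuousAt (fun x => (γ x).graphCurve) 0 :=
      (ContinuousMap.contDiff_graphCurve (E := E) (n := 0)).continuous.continuousAt.comp
        hγ.self_of_nhds.continuousAt
    have hmem : MapsTo (γ 0).graphCurve univ O := by
      intro t _
      rw [hγ0]
      exact hKO (by simp)
    exact (hcont.eventually (hopen.mem_nhds hmem)).mono fun x hx t => hOW (hx (mem_univ t))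
  have h0I : (0 : ℝ) ∈ unitInterval := unitInterval.zero_mem
  have h1I : (1 : ℝ) ∈ unitInterval := unitInterval.one_mem
  let ev : C(unitInterval, E) →L[ℝ] E := ContinuousMap.evalCLM ℝ 1
  refine ⟨fun x => γ x 1, hγ.mono fun x hx => ev.contDiff.contDiffAt.comp x hx, by simp [hγ0], ?_⟩
  filter_upwards [hev.eventually_nhds, hdiff, hWev] with x hx hd hxW
  have hxe := hx.self_of_nhds
  -- The integral equation holds on a neighbourhood of `x`, so it may be differentiated in `x`; this
  -- is the variational equation in integral form.
  have hvar (u : E) : fderiv ℝ γ x u = ContinuousMap.const _ u + ContinuousMap.primitiveL E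
      (ContinuousMap.pointwiseApplyL unitInterval (ℝ × E) E (f'.comp (γ x).graphCurve)
        ((ContinuousLinearMap.inr ℝ ℝ E).compLeftContinuous ℝ unitInterval (fderiv ℝ γ x u))) := by
    have hcomp := (ContinuousLinearMap.const ℝ unitInterval (M := E)).hasFDerivAt (x := x) |>.add
      ((ContinuousMap.primitiveL E).hasFDerivAt.comp x
      ((ContinuousMap.hasFDerivAt_comp f f'
        (fun x => (hX.differentiable (by simp) x).hasFDerivAt) _).comp x
        ((ContinuousMap.hasFDerivAt_graphCurve (γ x)).comp x hd.hasFDerivAt)))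
    have := hd.hasFDerivAt.unique (hcomp.congr_of_eventuallyEq hx)
    exact congrArg (fun L : E →L[ℝ] C(unitInterval, E) => L u) this
  refine ⟨(γ x).extendUnit, fun s u => (fderiv ℝ γ x u).extendUnit s, ?_, ?_, ?_, ?_⟩
  · rw [ContinuousMap.extendUnit_of_mem _ h1I]; rfl
  · intro u
    beta_reduce
    rw [ContinuousMap.extendUnit_of_mem _ h0I, hvar u]
    simp [ContinuousMap.primitiveL_apply]
  · intro u
    have : HasFDerivAt (fun x => γ x 1) (ev ∘L fderiv ℝ γ x) x :=
      ev.hasFDerivAt.comp x hd.hasFDerivAt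
    beta_reduce
    rw [this.fderiv, ContinuousMap.extendUnit_of_mem _ h1I]
    rfl
  · intro t ht
    refine ⟨?_, ?_, fun u => ?_⟩
    · simpa [ContinuousMap.extendUnit_of_mem _ ht] using hxW ⟨t, ht⟩
    · have := ContinuousMap.hasDerivWithinAt_extendUnit_of_eq_primitive hxe ht
      simpa [f, ContinuousMap.extendUnit_of_mem _ ht] using this
    · have := ContinuousMap.hasDerivWithinAt_extendUnit_of_eq_primitive (hvar u) ht
      simpa [f', ContinuousMap.extendUnit_of_mem _ ht] using this

end IntegralCurve

/-! ### The Poincaré lemma and Moser's argument -/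

section Poincare

universe u
variable {E F : Type u} [NormedAddCommGroup E] [NormedSpace ℝ E]
  [NormedAddCommGroup F] [NormedSpace ℝ F]

/-- Multiplication of a curve by the time parameter. -/
noncomputable def ContinuousMap.timeSmulL (F : Type*) [NormedAddCommGroup F] [NormedSpace ℝ F] :
    C(unitInterval, F) →L[ℝ] C(unitInterval, F) :=
  ContinuousMap.pointwiseApplyL unitInterval F F
    ⟨fun s => (s : ℝ) • ContinuousLinearMap.id ℝ F, by fun_prop⟩

@[simp] theorem ContinuousMap.timeSmulL_apply (c : C(unitInterval, F)) (s : unitInterval) :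
    ContinuousMap.timeSmulL F c s = (s : ℝ) • c s := rfl

theorem ContinuousMap.primitiveL_one_eq (c : C(unitInterval, F)) {g : ℝ → F}
    (h : ∀ s : unitInterval, c s = g s) :
    ContinuousMap.primitiveL F c 1 = ∫ s in (0 : ℝ)..1, g s := by
  rw [ContinuousMap.primitiveL_apply]
  refine intervalIntegral.integral_congr fun s hs => ?_
  rw [uIcc_of_le (by simp)] at hs
  rw [ContinuousMap.extendUnit_of_mem _ hs, h]

/-- The integral is postcomposition by `b` between two bounded linear maps, so differentiation under
the integral sign is the chain rule. -/
theorem contDiff_integral_smul_ray {b : E → F} (hb : ContDiff ℝ ∞ b) :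
    ContDiff ℝ ∞ (fun x => ∫ s in (0 : ℝ)..1, s • b (s • x)) ∧
    ∀ x u, fderiv ℝ (fun x => ∫ s in (0 : ℝ)..1, s • b (s • x)) x u =
      ∫ s in (0 : ℝ)..1, s • fderiv ℝ b (s • x) (s • u) := by
  set f : C(E, F) := ⟨b, hb.continuous⟩
  have hb' : Continuous (fderiv ℝ b) := hb.continuous_fderiv (by simp)
  set f' : C(E, E →L[ℝ] F) := ⟨fderiv ℝ b, hb'⟩
  let ray : E →L[ℝ] C(unitInterval, E) :=
    (ContinuousMap.timeSmulL E).comp (ContinuousLinearMap.const ℝ unitInterval (M := E))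
  let J : C(unitInterval, F) →L[ℝ] F :=
    (ContinuousMap.evalCLM ℝ 1).comp ((ContinuousMap.primitiveL F).comp (ContinuousMap.timeSmulL F))
  have hray (x : E) (s : unitInterval) : ray x s = (s : ℝ) • x := rfl
  have hJ : (fun x => ∫ s in (0 : ℝ)..1, s • b (s • x)) = fun x => J (f.comp (ray x)) := by
    funext x
    exact (ContinuousMap.primitiveL_one_eq _ fun s => by simp [f, hray]).symm
  rw [hJ]
  refine ⟨J.contDiff.comp ((ContinuousMap.contDiff_comp f hb).comp ray.contDiff), fun x u => ?_⟩
  have hd := J.hasFDerivAt.comp x ((ContinuousMap.hasFDerivAt_comp f f'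
      (fun x => (hb.differentiable (by simp) x).hasFDerivAt) _).comp x ray.hasFDerivAt)
  refine (DFunLike.congr_fun hd.fderiv u).trans ?_
  exact ContinuousMap.primitiveL_one_eq _ fun s => by simp [f', hray]

end Poincare

section Moser

universe u
variable {E : Type u} [NormedAddCommGroup E] [NormedSpace ℝ E]

theorem hasFDerivAt_apply_apply {b : E → E →L[ℝ] E →L[ℝ] ℝ} {b' : E →L[ℝ] E →L[ℝ] E →L[ℝ] ℝ}
    {x : E}
    (hb : HasFDerivAt b b' x) (u v : E) :
    HasFDerivAt (fun y => b y u v) ((ContinuousLinearMap.apply ℝ ℝ v ∘L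
        ContinuousLinearMap.apply ℝ (E →L[ℝ] ℝ) u) ∘L b') x :=
  ContinuousLinearMap.hasFDerivAt (ContinuousLinearMap.apply ℝ ℝ v ∘L
        ContinuousLinearMap.apply ℝ (E →L[ℝ] ℝ) u) |>.comp x hb

theorem fderiv_apply_apply_eq_neg {b : E → E →L[ℝ] E →L[ℝ] ℝ} {x : E}
    (hb : DifferentiableAt ℝ b x) (hskew : ∀ᶠ y in 𝓝 x, ∀ u v, b y u v = -b y v u) (w u v : E) :
    fderiv ℝ b x w u v = -fderiv ℝ b x w v u := by
  have h1 := hasFDerivAt_apply_apply hb.hasFDerivAt u v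
  have h2 := (hasFDerivAt_apply_apply hb.hasFDerivAt v u).neg
  exact DFunLike.congr_fun
    (h1.unique (h2.congr_of_eventuallyEq (hskew.mono fun y hy => hy u v))) w

/-- Poincaré's lemma for closed `2`-forms on a ball. -/
theorem exists_primitive_of_closed {b : E → E →L[ℝ] E →L[ℝ] ℝ} (hb : ContDiff ℝ ∞ b)
    (hb0 : b 0 = 0) {r : ℝ} (hskew : ∀ x ∈ Metric.ball (0 : E) r, ∀ u v, b x u v = -b x v u)
    (hclosed : ∀ x ∈ Metric.ball (0 : E) r, ∀ u v w,
      fderiv ℝ b x u v w - fderiv ℝ b x v u w + fderiv ℝ b x w u v = 0) :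
    ∃ α : E → E →L[ℝ] ℝ, ContDiff ℝ ∞ α ∧ α 0 = 0 ∧ fderiv ℝ α 0 = 0 ∧
      ∀ x ∈ Metric.ball (0 : E) r, ∀ u v,
        fderiv ℝ α x u v - fderiv ℝ α x v u = b x u v := by
  obtain ⟨hΓ, hΓ'⟩ := contDiff_integral_smul_ray hb
  set Γ : E → E →L[ℝ] E →L[ℝ] ℝ := fun x => ∫ s in (0 : ℝ)..1, s • b (s • x)
  have hα (x : E) : HasFDerivAt (fun x => Γ x x) (Γ x ∘L .id ℝ E + (fderiv ℝ Γ x).flip x) x :=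
    (hΓ.differentiable (by simp) x).hasFDerivAt.clm_apply (hasFDerivAt_id x)
  -- The radial homotopy formula `α_x(v) = ∫₀¹ s b_{sx}(x, v) ds`.
  refine ⟨fun x => Γ x x, hΓ.clm_apply contDiff_id, by simp, ?_, fun x hx u v => ?_⟩
  · rw [(hα 0).fderiv]
    have : Γ 0 = 0 := by simp [Γ, hb0]
    simp [this]
  · have hbc : Continuous b := hb.continuous
    have hb'c : Continuous (fderiv ℝ b) := hb.continuous_fderiv (by simp)
    rw [(hα x).fderiv]
    have hΓuv (u v : E) : Γ x u v = ∫ s in (0 : ℝ)..1, s * b (s • x) u v := by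
      have hi : IntervalIntegrable (fun s : ℝ => s • b (s • x)) MeasureTheory.volume 0 1 :=
        Continuous.intervalIntegrable (by fun_prop) _ _
      exact ((ContinuousLinearMap.apply ℝ ℝ v ∘L
        ContinuousLinearMap.apply ℝ (E →L[ℝ] ℝ) u).intervalIntegral_comp_comm hi).symm
    have hΓ'uv (u v : E) : fderiv ℝ Γ x u x v =
        ∫ s in (0 : ℝ)..1, s * fderiv ℝ b (s • x) (s • u) x v := by
      have hi : IntervalIntegrable (fun s : ℝ => s • fderiv ℝ b (s • x) (s • u))
          MeasureTheory.volume 0 1 := Continuous.intervalIntegrable (by fun_prop) _ _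
      rw [hΓ']
      exact ((ContinuousLinearMap.apply ℝ ℝ v ∘L
        ContinuousLinearMap.apply ℝ (E →L[ℝ] ℝ) x).intervalIntegral_comp_comm hi).symm
    -- Skewness and closedness turn the integrand of `dα(u, v)` into this derivative, whose integral
    -- over `[0,1]` is `b x u v`.
    have hderiv (s : ℝ) : HasDerivAt (fun s : ℝ => s ^ 2 * b (s • x) u v)
        (2 * s * b (s • x) u v + s ^ 2 * fderiv ℝ b (s • x) x u v) s := by
      have h1 : HasDerivAt (fun s : ℝ => b (s • x)) (fderiv ℝ b (s • x) x) s := by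
        refine HasDerivAt.congr_deriv (((hb.differentiable (by simp) (s • x)).hasFDerivAt).comp_hasDerivAt
          s
          ((hasDerivAt_id s).smul_const x)) (by simp)
      have h2 := (ContinuousLinearMap.apply ℝ ℝ v ∘L
        ContinuousLinearMap.apply ℝ (E →L[ℝ] ℝ) u).hasFDerivAt.comp_hasDerivAt s h1
      exact ((hasDerivAt_pow 2 s).mul h2).congr_deriv (by simp)
    have hFTC := intervalIntegral.integral_eq_sub_of_hasDerivAt (a := 0) (b := 1)
      (fun s _ => hderiv s) (Continuous.intervalIntegrable (by fun_prop) _ _)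
    simp only [ContinuousLinearMap.comp_id, add_apply,
      ContinuousLinearMap.flip_apply, hΓuv, hΓ'uv]
    rw [← intervalIntegral.integral_add, ← intervalIntegral.integral_add,
      ← intervalIntegral.integral_sub]
    · trans ∫ s in (0 : ℝ)..1, (2 * s * b (s • x) u v + s ^ 2 * fderiv ℝ b (s • x) x u v)
      · refine intervalIntegral.integral_congr fun s hs => ?_
        rw [uIcc_of_le zero_le_one] at hs
        have hsx : s • x ∈ Metric.ball (0 : E) r := by
          rw [mem_ball_zero_iff] at hx ⊢
          rw [norm_smul, Real.norm_of_nonneg hs.1]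
          exact (mul_le_of_le_one_left (norm_nonneg _) hs.2).trans_lt hx
        have h1 := hskew _ hsx u v
        have h2 := hclosed _ hsx u v x
        have h3 (w y : E) : fderiv ℝ b (s • x) w x y = -fderiv ℝ b (s • x) w y x :=
          fderiv_apply_apply_eq_neg (hb.differentiable (by simp) _)
            (Filter.mem_of_superset (Metric.isOpen_ball.mem_nhds hsx) hskew) w x y
        simp only [map_smul, smul_apply, smul_eq_mul]
        rw [h3 u v, h3 v u]
        linear_combination -s * h1 - s ^ 2 * h2
      · rw [hFTC]; simp
    all_goals exact Continuous.intervalIntegrable (by fun_prop) _ _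


/-- Moser's theorem: near a point where it is non-degenerate, a closed `2`-form is the pullback of
a constant one. -/
theorem exists_pullback_eq_const [FiniteDimensional ℝ E] {b : E → E →L[ℝ] E →L[ℝ] ℝ}
    (hb : ContDiff ℝ ∞ b) {r : ℝ} (hr : 0 < r)
    (hskew : ∀ x ∈ Metric.ball (0 : E) r, ∀ u v, b x u v = -b x v u)
    (hclosed : ∀ x ∈ Metric.ball (0 : E) r, ∀ u v w,
      fderiv ℝ b x u v w - fderiv ℝ b x v u w + fderiv ℝ b x w u v = 0)
    (hnd : ∀ v, v ≠ 0 → ∃ w, b 0 v w ≠ 0) :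
    ∃ ψ : E → E, (∀ᶠ x in 𝓝 0, ContDiffAt ℝ ∞ ψ x) ∧ ψ 0 = 0 ∧
      ∀ᶠ x in 𝓝 0, ∀ u v, b (ψ x) (fderiv ℝ ψ x u) (fderiv ℝ ψ x v) = b 0 u v := by
  have hβ : ContDiff ℝ ∞ (fun x => b x - b 0) := hb.sub contDiff_const
  have hβ' (x : E) : fderiv ℝ (fun x => b x - b 0) x = fderiv ℝ b x := fderiv_sub_const _
  have h0r : (0 : E) ∈ Metric.ball (0 : E) r := Metric.mem_ball_self hr
  obtain ⟨α, hα, hα0, hα'0, hdα⟩ := exists_primitive_of_closed hβ (sub_self _) (r := r)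
    (fun x hx u v => by
      simp only [sub_apply]; linear_combination hskew x hx u v - hskew 0 h0r u v)
    (fun x hx u v w => by rw [hβ']; exact hclosed x hx u v w)
  let Ω : ℝ × E → E →L[ℝ] E →L[ℝ] ℝ := fun z => b 0 + z.1 • (b z.2 - b 0)
  have hΩ : ContDiff ℝ ∞ Ω :=
    contDiff_const.add (contDiff_fst.smul (hβ.comp contDiff_snd))
  have hΩ' (z : ℝ × E) : HasFDerivAt Ω
      (z.1 • (fderiv ℝ b z.2 ∘L ContinuousLinearMap.snd ℝ ℝ E) +
        (ContinuousLinearMap.fst ℝ ℝ E).smulRight (b z.2 - b 0)) z := by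
    have h1 : HasFDerivAt (fun z : ℝ × E => b z.2 - b 0)
        (fderiv ℝ b z.2 ∘L ContinuousLinearMap.snd ℝ ℝ E) z :=
      ((hb.differentiable (by simp) z.2).hasFDerivAt.comp z hasFDerivAt_snd).sub_const _
    exact (hasFDerivAt_fst.smul h1).const_add _
  have hb0 : ∃ e : E ≃L[ℝ] (E →L[ℝ] ℝ), (e : E →L[ℝ] E →L[ℝ] ℝ) = b 0 := by
    have hinj : Function.Injective (b 0).toLinearMap := by
      refine (injective_iff_map_eq_zero _).2 fun v hv => ?_
      by_contra hne
      obtain ⟨w, hw⟩ := hnd v hne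
      exact hw (DFunLike.congr_fun hv w)
    have hdim : Module.finrank ℝ E = Module.finrank ℝ (E →L[ℝ] ℝ) := by
      rw [← LinearMap.toContinuousLinearMap.finrank_eq]
      exact Subspace.dual_finrank_eq.symm
    refine ⟨(LinearEquiv.ofInjectiveOfFinrankEq _ hinj hdim).toContinuousLinearEquiv, ?_⟩
    ext v w
    rfl
  set W : Set (ℝ × E) := Ω ⁻¹' range ((↑) : (E ≃L[ℝ] (E →L[ℝ] ℝ)) → (E →L[ℝ] E →L[ℝ] ℝ))
  have hW : IsOpen W := ContinuousLinearEquiv.isOpen.preimage hΩ.continuous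
  have hΩt0 (t : ℝ) : Ω (t, 0) = b 0 := by simp [Ω]
  set K : Set (ℝ × E) := unitInterval ×ˢ {(0 : E)}
  have hK : IsCompact K := isCompact_Icc.prod isCompact_singleton
  have hKW : K ⊆ W := by
    rintro ⟨t, x⟩ ⟨-, rfl : x = 0⟩
    exact hb0.imp fun e he => he.trans (hΩt0 t).symm
  let Y : ℝ × E → E := fun z => -((Ω z).inverse (α z.2))
  have hinv : ∀ z ∈ W, ContDiffAt ℝ ∞ (fun z => (Ω z).inverse) z := by
    rintro z ⟨e, he⟩
    have := contDiffAt_map_inverse (𝕜 := ℝ) (n := ∞) e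
    rw [he] at this
    exact this.comp z hΩ.contDiffAt
  have hY : ∀ z ∈ W, ContDiffAt ℝ ∞ Y z := fun z hz =>
    ((hinv z hz).clm_apply (hα.comp contDiff_snd).contDiffAt).neg
  -- `Y` is known to be smooth only where `Ω` is invertible; the flow construction needs a globally
  -- smooth field.
  obtain ⟨X, hX, hXY⟩ := exists_contDiff_eventuallyEq_nhdsSet hW
    (fun z hz => (hY z hz).contDiffWithinAt) hK hKW
  have hXY' : ∀ᶠ z in 𝓝ˢ K, X =ᶠ[𝓝 z] Y :=
    eventually_nhdsSet_iff_forall.2 fun z hz =>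
      eventually_eventually_nhds.2 (eventually_nhdsSet_iff_forall.1 hXY z hz)
  have hX0 : ∀ t ∈ unitInterval, X (t, 0) = 0 := fun t ht => by
    have htK : (t, (0 : E)) ∈ K := ⟨ht, rfl⟩
    rw [(hXY'.self_of_nhdsSet _ htK).eq_of_nhds]
    simp [Y, hα0]
  have hX1 : ∀ t ∈ unitInterval, fderiv ℝ X (t, 0) = 0 := fun t ht => by
    have htK : (t, (0 : E)) ∈ K := ⟨ht, rfl⟩
    rw [(hXY'.self_of_nhdsSet _ htK).fderiv_eq]
    have h1 := ((hinv _ (hKW htK)).differentiableAt (by simp)).hasFDerivAt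
    have h2 : HasFDerivAt (fun z : ℝ × E => α z.2)
        (fderiv ℝ α 0 ∘L ContinuousLinearMap.snd ℝ ℝ E) (t, 0) :=
      HasFDerivAt.comp (t, (0 : E)) (hα.differentiable (by simp) 0).hasFDerivAt hasFDerivAt_snd
    have h3 : HasFDerivAt Y _ (t, 0) := (h1.clm_apply h2).neg
    rw [h3.fderiv]
    ext z <;> simp [hα0, hα'0]
  set V : Set (ℝ × E) := {z | z ∈ W ∧ X =ᶠ[𝓝 z] Y ∧ z.2 ∈ Metric.ball (0 : E) r}
  have hV : V ∈ 𝓝ˢ K := by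
    refine Filter.inter_mem (hW.mem_nhdsSet.2 hKW) (Filter.inter_mem hXY' ?_)
    refine (Metric.isOpen_ball.preimage continuous_snd).mem_nhdsSet.2 ?_
    rintro ⟨t, x⟩ ⟨-, rfl : x = 0⟩
    exact h0r
  have hΩX : ∀ z ∈ W, Ω z (Y z) = -α z.2 := by
    rintro z ⟨e, he⟩
    simp only [Y, ← he, ContinuousLinearMap.inverse_equiv, map_neg]
    simp
  -- Differentiating `Ω(X) = -α` in the space direction avoids any formula for the derivative of the
  -- inverse.
  have hlin : ∀ z ∈ V, ∀ u : E, z.1 • fderiv ℝ b z.2 u (X z) + Ω z (fderiv ℝ X z (0, u)) =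
      -fderiv ℝ α z.2 u := by
    rintro z ⟨hzW, hzX, -⟩ u
    have h1 : HasFDerivAt (fun z => Ω z (X z)) _ z :=
      (hΩ' z).clm_apply (hX.differentiable (by simp) z).hasFDerivAt
    have h2 : HasFDerivAt (fun z : ℝ × E => -α z.2)
        (-(fderiv ℝ α z.2 ∘L ContinuousLinearMap.snd ℝ ℝ E)) z :=
      ((hα.differentiable (by simp) z.2).hasFDerivAt.comp z hasFDerivAt_snd).neg
    have h3 : (fun z => Ω z (X z)) =ᶠ[𝓝 z] fun z => -α z.2 := by
      filter_upwards [hzX, hW.mem_nhds hzW] with y hy hyW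
      rw [hy, hΩX y hyW]
    have h4 := DFunLike.congr_fun (h1.unique (h2.congr_of_eventuallyEq h3)) (0, u)
    simpa [add_comm] using h4
  obtain ⟨ψ, hψ, hψ0, hev⟩ := exists_flow_with_variation hX hX0 hX1 hV
  refine ⟨ψ, hψ, hψ0, hev.mono ?_⟩
  rintro x ⟨γ, A, hγ1, hA0, hA1, hflow⟩ u v
  -- Moser's cancellation along a trajectory: `hlin` at both vectors, `dα = b - b 0` and closedness
  -- of `b` make the derivative of the transported form vanish.
  have hg : ∀ t ∈ unitInterval,
      HasDerivWithinAt (fun t => Ω (t, γ t) (A t u) (A t v)) 0 unitInterval t := by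
    intro t ht
    obtain ⟨hVt, hγ', hA'⟩ := hflow t ht
    have h1 := (hΩ' (t, γ t)).comp_hasDerivWithinAt t ((hasDerivWithinAt_id t _).prodMk hγ')
    have h2 := (h1.clm_apply (hA' u)).clm_apply (hA' v)
    refine h2.congr_deriv ?_
    have e1 := DFunLike.congr_fun (hlin _ hVt (A t u)) (A t v)
    have e2 := DFunLike.congr_fun (hlin _ hVt (A t v)) (A t u)
    have e3 := hdα _ hVt.2.2 (A t u) (A t v)
    have e4 := hclosed _ hVt.2.2 (X (t, γ t)) (A t u) (A t v)
    have e5 : Ω (t, γ t) (A t u) (fderiv ℝ X (t, γ t) (0, A t v)) =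
        -Ω (t, γ t) (fderiv ℝ X (t, γ t) (0, A t v)) (A t u) := by
      simp only [Ω, add_apply, smul_apply, sub_apply, smul_eq_mul]
      linear_combination (1 - t) * hskew 0 h0r (A t u) (fderiv ℝ X (t, γ t) (0, A t v)) +
        t * hskew _ hVt.2.2 (A t u) (fderiv ℝ X (t, γ t) (0, A t v))
    simp only [add_apply, smul_apply, smul_eq_mul, neg_apply, sub_apply] at e1 e2 e3
    simp only [add_apply, smul_apply, smul_eq_mul, Function.comp_apply, id_eq, e5,
      ContinuousLinearMap.comp_apply, ContinuousLinearMap.coe_snd', ContinuousLinearMap.coe_fst',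
      ContinuousLinearMap.smulRight_apply, sub_apply, one_mul]
    linear_combination e1 - e2 - e3 + t * e4
  have hconst := constant_of_derivWithin_zero
    (fun t ht => (hg t ht).differentiableWithinAt)
    (fun t ht => (hg t (Ico_subset_Icc_self ht)).derivWithin
      (uniqueDiffOn_Icc zero_lt_one t (Ico_subset_Icc_self ht)))
    1 unitInterval.one_mem
  simpa [Ω, hγ1, hA0, hA1] using hconst

end Moser

/-! ### Linear Darboux theorem -/

section LinearAlgebra

variable {E : Type*} [NormedAddCommGroup E] [NormedSpace ℝ E]

/-- A non-degenerate alternating bilinear form admits symplectic families of every length up to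
half the dimension. -/
theorem exists_symplectic_family [FiniteDimensional ℝ E] {n : ℕ}
    (hdim : Module.finrank ℝ E = 2 * n)
    (b : E →L[ℝ] E →L[ℝ] ℝ) (hskew : ∀ u v, b u v = -b v u) (hnd : ∀ v, v ≠ 0 → ∃ w, b v w ≠ 0)
    (k : ℕ) (hk : k ≤ n) :
    ∃ e f : Fin k → E, (∀ i j, b (e i) (e j) = 0) ∧ (∀ i j, b (f i) (f j) = 0) ∧
      ∀ i j, b (e i) (f j) = if i = j then 1 else 0 := by
  induction k with
  | zero => exact ⟨Fin.elim0, Fin.elim0, fun i => i.elim0, fun i => i.elim0, fun i => i.elim0⟩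
  | succ k ih =>
    obtain ⟨e, f, hee, hff, hef⟩ := ih (by omega)
    have halt (v : E) : b v v = 0 := by linarith [hskew v v]
    let T : E →ₗ[ℝ] (Fin k → ℝ) × (Fin k → ℝ) :=
      (LinearMap.pi fun i => (b (e i)).toLinearMap).prod
        (LinearMap.pi fun i => (b (f i)).toLinearMap)
    -- The `2k` conditions of orthogonality to the family cannot exhaust a space of dimension `2n >
    -- 2k`.
    obtain ⟨v, hv, hv0⟩ : ∃ v, T v = 0 ∧ v ≠ 0 := by
      have : LinearMap.ker T ≠ ⊥ := LinearMap.ker_ne_bot_of_finrank_lt (by simp [hdim]; omega)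
      obtain ⟨v, hv, hv0⟩ := (Submodule.ne_bot_iff _).1 this
      exact ⟨v, hv, hv0⟩
    have hev (i : Fin k) : b (e i) v = 0 := congrFun (congrArg Prod.fst hv) i
    have hfv (i : Fin k) : b (f i) v = 0 := congrFun (congrArg Prod.snd hv) i
    obtain ⟨w, hw⟩ := hnd v hv0
    -- Symplectic Gram–Schmidt: the corrections make `w'` orthogonal to the family and leave the
    -- pairing with `v` unchanged, since `v` is orthogonal to it.
    let w' : E := (b v w)⁻¹ • (w - ∑ i, b (e i) w • f i + ∑ i, b (f i) w • e i)
    have hew (j : Fin k) : b (e j) w' = 0 := by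
      simp [w', hee, hef]
    have hfw (j : Fin k) : b (f j) w' = 0 := by
      have hfe (i : Fin k) : b (f j) (e i) = -if i = j then 1 else 0 := by rw [hskew, hef]
      simp [w', hff, hfe]
    have hve (i : Fin k) : b v (e i) = 0 := by rw [hskew, hev, neg_zero]
    have hvf (i : Fin k) : b v (f i) = 0 := by rw [hskew, hfv, neg_zero]
    have hwf (i : Fin k) : b w' (f i) = 0 := by rw [hskew, hfw, neg_zero]
    have hvw : b v w' = 1 := by
      simp [w', hve, hvf, hw]
    have hwv : b w' (v) = -1 := by rw [hskew, hvw]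
    refine ⟨Fin.snoc e v, Fin.snoc f w', ?_, ?_, ?_⟩
    · intro i j
      refine Fin.lastCases ?_ (fun i => ?_) i <;> refine Fin.lastCases ?_ (fun j => ?_) j <;>
        simp [halt, hee, hve, hev]
    · intro i j
      refine Fin.lastCases ?_ (fun i => ?_) i <;> refine Fin.lastCases ?_ (fun j => ?_) j <;>
        simp [halt, hff, hfw, hwf]
    · intro i j
      refine Fin.lastCases ?_ (fun i => ?_) i <;> refine Fin.lastCases ?_ (fun j => ?_) j <;>
        simp [hef, hvf, hew, hvw, Fin.castSucc_ne_last, (Fin.castSucc_ne_last _).symm]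

end LinearAlgebra

namespace Symplectic

theorem standardForm_apply (n : ℕ) (x : EuclideanSpace ℝ (Fin (2 * n)))
    (u v : EuclideanSpace ℝ (Fin (2 * n))) :
    (standardForm n x : EuclideanSpace ℝ (Fin (2 * n)) [⋀^Fin 2]→L[ℝ] ℝ) ![u, v] =
      ∑ i, (dx i u * dy i v - dx i v * dy i u) := by
  have h : (∑ i : Fin n, wedge (dx i) (dy i) : EuclideanSpace ℝ (Fin (2 * n)) [⋀^Fin 2]→L[ℝ] ℝ)
      ![u, v] = ∑ i, (dx i u * dy i v - dx i v * dy i u) := by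
    rw [ContinuousAlternatingMap.sum_apply]
    rfl
  exact h

theorem exists_dx_dy_of_ne_zero {n : ℕ} {u : EuclideanSpace ℝ (Fin (2 * n))} (hu : u ≠ 0) :
    ∃ i : Fin n, dx i u ≠ 0 ∨ dy i u ≠ 0 := by
  by_contra! h
  refine hu (PiLp.ext fun j => ?_)
  by_cases hj : (j : ℕ) < n
  · exact (h ⟨j, hj⟩).1
  · have := (h ⟨j - n, by omega⟩).2
    have hj' : (⟨n + (j - n), by omega⟩ : Fin (2 * n)) = j := Fin.ext (by simp; omega)
    simpa [dy, hj'] using this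

theorem standardForm_nondegenerate {n : ℕ} {u : EuclideanSpace ℝ (Fin (2 * n))} (hu : u ≠ 0) :
    ∃ v : EuclideanSpace ℝ (Fin (2 * n)), ∑ i : Fin n, (dx i u * dy i v - dx i v * dy i u) ≠ 0 := by
  obtain ⟨i, hi⟩ := exists_dx_dy_of_ne_zero hu
  have hx (j : Fin n) (k : Fin (2 * n)) :
      dx j (EuclideanSpace.single k (1 : ℝ)) = if (j : ℕ) = k then 1 else 0 := by
    simp [dx, Fin.ext_iff]
  have hy (j : Fin n) (k : Fin (2 * n)) :
      dy j (EuclideanSpace.single k (1 : ℝ)) = if n + (j : ℕ) = k then 1 else 0 := by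
    simp [dy, Fin.ext_iff]
  rcases hi with hi | hi
  · refine ⟨EuclideanSpace.single ⟨n + i, by omega⟩ 1, ?_⟩
    have h (j : Fin n) : (j : ℕ) ≠ n + i := by omega
    simpa [hx, hy, h, Fin.val_inj] using hi
  · refine ⟨EuclideanSpace.single ⟨i, by omega⟩ 1, ?_⟩
    have h (j : Fin n) : n + (j : ℕ) ≠ i := by omega
    simpa [hx, hy, h, Fin.val_inj] using hi

/-- The linear Darboux theorem. -/
theorem exists_linear_symplectic_frame {n : ℕ}
    (b : EuclideanSpace ℝ (Fin (2 * n)) →L[ℝ] EuclideanSpace ℝ (Fin (2 * n)) →L[ℝ] ℝ)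
    (hskew : ∀ u v, b u v = -b v u) (hnd : ∀ v, v ≠ 0 → ∃ w, b v w ≠ 0) :
    ∃ S : EuclideanSpace ℝ (Fin (2 * n)) →L[ℝ] EuclideanSpace ℝ (Fin (2 * n)),
      ∀ u v, b (S u) (S v) = ∑ i : Fin n, (dx i u * dy i v - dx i v * dy i u) := by
  obtain ⟨e, f, hee, hff, hef⟩ := exists_symplectic_family (n := n) (by simp) b hskew hnd n le_rfl
  have hfe (i j : Fin n) : b (f i) (e j) = -if j = i then 1 else 0 := by rw [hskew, hef]
  refine ⟨∑ i : Fin n, ((dx i).smulRight (e i) + (dy i).smulRight (f i)), fun u v => ?_⟩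
  simp [hee, hff, hef, hfe, Finset.sum_add_distrib, sub_eq_add_neg,
    mul_comm]

/-! ### From alternating forms to Darboux charts -/

section LocalForm

variable {E : Type*} [NormedAddCommGroup E] [NormedSpace ℝ E]

/-- An alternating `2`-form as a bilinear form. -/
noncomputable def toBilinL (E : Type*) [NormedAddCommGroup E] [NormedSpace ℝ E] :
    (E [⋀^Fin 2]→L[ℝ] ℝ) →L[ℝ] E →L[ℝ] E →L[ℝ] ℝ :=
  (ContinuousLinearMap.compL ℝ E (E [⋀^Fin 1]→L[ℝ] ℝ) (E →L[ℝ] ℝ)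
    ((ContinuousAlternatingMap.ofSubsingletonLIE (𝕜 := ℝ) (E := E) (F := ℝ)
      (0 : Fin 1)).symm.toContinuousLinearEquiv : (E [⋀^Fin 1]→L[ℝ] ℝ) →L[ℝ] E →L[ℝ] ℝ)) ∘L
  (ContinuousAlternatingMap.curryLeftLI (n := 1)).toContinuousLinearMap

theorem toBilinL_apply (σ : E [⋀^Fin 2]→L[ℝ] ℝ) (u v : E) : toBilinL E σ u v = σ ![u, v] := by
  have : toBilinL E σ u v = σ (Matrix.vecCons u (fun _ => v)) := rfl
  rw [this]
  congr 1
  ext i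
  fin_cases i <;> rfl

theorem toBilinL_skew (σ : E [⋀^Fin 2]→L[ℝ] ℝ) (u v : E) :
    toBilinL E σ u v = -toBilinL E σ v u := by
  rw [toBilinL_apply, toBilinL_apply]
  have := σ.toAlternatingMap.map_swap ![v, u] (i := 0) (j := 1) (by simp)
  have h : ![v, u] ∘ Equiv.swap (0 : Fin 2) 1 = ![u, v] := by
    ext i; fin_cases i <;> simp
  rwa [h] at this

theorem fderiv_toBilinL_cyclic {Ω : E → E [⋀^Fin 2]→L[ℝ] ℝ} {x : E} (hΩ : DifferentiableAt ℝ Ω x)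
    (hd : extDeriv Ω x = 0) (u v w : E) :
    fderiv ℝ (fun y => toBilinL E (Ω y)) x u v w - fderiv ℝ (fun y => toBilinL E (Ω y)) x v u w +
      fderiv ℝ (fun y => toBilinL E (Ω y)) x w u v = 0 := by
  have h := extDeriv_apply hΩ ![u, v, w]
  rw [hd] at h
  have hb : DifferentiableAt ℝ (fun y => toBilinL E (Ω y)) x :=
    (toBilinL E).differentiableAt.comp x hΩ
  have key (a c d : E) : fderiv ℝ (fun y => Ω y ![c, d]) x a =
      fderiv ℝ (fun y => toBilinL E (Ω y)) x a c d := by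
    have := (hasFDerivAt_apply_apply hb.hasFDerivAt c d).fderiv
    simp only [toBilinL_apply] at this
    rw [this]
    rfl
  have r0 : (0 : Fin 3).removeNth ![u, v, w] = ![v, w] := by ext i; fin_cases i <;> rfl
  have r1 : (1 : Fin 3).removeNth ![u, v, w] = ![u, w] := by ext i; fin_cases i <;> rfl
  have r2 : (2 : Fin 3).removeNth ![u, v, w] = ![u, v] := by ext i; fin_cases i <;> rfl
  rw [Fin.sum_univ_three, r0, r1, r2, key, key, key] at h
  simp at h
  linear_combination -h

end LocalForm

/-- The phase space `ℝ²ⁿ`. -/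
abbrev Phase (n : ℕ) : Type := EuclideanSpace ℝ (Fin (2 * n))

/-- Darboux's theorem on an open subset of Euclidean space. -/
theorem exists_darboux_coordinates {n : ℕ}
    {Ω : Phase n → Phase n [⋀^Fin 2]→L[ℝ] ℝ}
    {U : Set (Phase n)} (hU : IsOpen U) (hΩ : ContDiffOn ℝ ∞ Ω U)
    (hclosed : ∀ y ∈ U, extDeriv Ω y = 0) {p : Phase n} (hp : p ∈ U)
    (hnd : ∀ v, v ≠ 0 → ∃ w, Ω p ![v, w] ≠ 0) :
    ∃ G : OpenPartialHomeomorph (Phase n) (Phase n),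
      0 ∈ G.source ∧ G 0 = p ∧ ∀ z ∈ G.source, G z ∈ U ∧ ContDiffAt ℝ ∞ G z ∧
        ContDiffAt ℝ ∞ G.symm (G z) ∧
        ∀ u v, Ω (G z) ![fderiv ℝ G z u, fderiv ℝ G z v] =
          ∑ i : Fin n, (dx i u * dy i v - dx i v * dy i u) := by
  let U₀ : Set (Phase n) := (fun x => p + x) ⁻¹' U
  have hU₀ : IsOpen U₀ := hU.preimage (continuous_const.add continuous_id)
  have h0U₀ : (0 : Phase n) ∈ U₀ := by simpa [U₀] using hp
  let b₀ : Phase n → (Phase n) →L[ℝ] (Phase n) →L[ℝ] ℝ := fun x => toBilinL (Phase n) (Ω (p + x))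
  have hb₀ : ContDiffOn ℝ ∞ b₀ U₀ :=
    (toBilinL (Phase n)).contDiff.comp_contDiffOn
      (hΩ.comp (contDiff_const.add contDiff_id).contDiffOn fun _ h => h)
  obtain ⟨b, hb, hbb₀⟩ := exists_contDiff_eventuallyEq_nhdsSet hU₀ hb₀ isCompact_singleton
    (singleton_subset_iff.2 h0U₀)
  rw [nhdsSet_singleton] at hbb₀
  obtain ⟨r, hr, hball⟩ := Metric.eventually_nhds_iff_ball.1
    ((eventually_eventually_nhds.2 hbb₀).and (hU₀.mem_nhds h0U₀))
  have hskew : ∀ x ∈ Metric.ball (0 : Phase n) r, ∀ u v, b x u v = -b x v u := fun x hx u v => by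
    rw [(hball x hx).1.self_of_nhds]
    exact toBilinL_skew _ u v
  have hbclosed : ∀ x ∈ Metric.ball (0 : Phase n) r, ∀ u v w,
      fderiv ℝ b x u v w - fderiv ℝ b x v u w + fderiv ℝ b x w u v = 0 := fun x hx u v w => by
    have h1 : fderiv ℝ b x = fderiv ℝ (fun y => toBilinL (Phase n) (Ω y)) (p + x) := by
      rw [Filter.EventuallyEq.fderiv_eq (hball x hx).1]
      exact fderiv_comp_add_left (f := fun y => toBilinL (Phase n) (Ω y)) p
    rw [h1]
    have hxU : p + x ∈ U := (hball x hx).2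
    exact fderiv_toBilinL_cyclic ((hΩ.contDiffAt (hU.mem_nhds hxU)).differentiableAt (by simp))
      (hclosed _ hxU) u v w
  have hb0 : b 0 = toBilinL (Phase n) (Ω p) := by
    rw [hbb₀.self_of_nhds]
    simp [b₀]
  have hbnd : ∀ v, v ≠ 0 → ∃ w, b 0 v w ≠ 0 := fun v hv => by
    obtain ⟨w, hw⟩ := hnd v hv
    exact ⟨w, by rwa [hb0, toBilinL_apply]⟩
  obtain ⟨ψ, hψ, hψ0, hψb⟩ := exists_pullback_eq_const hb hr hskew hbclosed hbnd
  obtain ⟨S, hS⟩ := exists_linear_symplectic_frame (b 0)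
    (hskew 0 (Metric.mem_ball_self hr)) hbnd
  -- The symplectic frame, then Moser's map, then the translation taking `0` to `p`.
  let g : Phase n → Phase n := fun z => p + ψ (S z)
  have hψc : Tendsto ψ (𝓝 0) (𝓝 0) := by
    simpa [ContinuousAt, hψ0] using hψ.self_of_nhds.continuousAt
  have hSc : Tendsto S (𝓝 0) (𝓝 0) := by simpa using S.continuous.tendsto 0
  have hgood : ∀ᶠ z in 𝓝 (0 : Phase n), g z ∈ U ∧ ContDiffAt ℝ ∞ g z ∧
      ∀ u v, Ω (g z) ![fderiv ℝ g z u, fderiv ℝ g z v] =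
        ∑ i : Fin n, (dx i u * dy i v - dx i v * dy i u) := by
    filter_upwards [hSc.eventually hψ, hSc.eventually hψb,
      hSc.eventually (hψc.eventually (hbb₀.and (hU₀.mem_nhds h0U₀)))] with z h1 h2 h3
    refine ⟨h3.2, contDiffAt_const.add (h1.comp z S.contDiff.contDiffAt), fun u v => ?_⟩
    have hd : HasFDerivAt g (fderiv ℝ ψ (S z) ∘L S) z :=
      ((h1.differentiableAt (by simp)).hasFDerivAt.comp z S.hasFDerivAt).const_add p
    rw [hd.fderiv, ← hS, ← h2 (S u) (S v), h3.1, ← toBilinL_apply]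
    rfl
  -- A linear map pulling some form back to a non-degenerate one is injective, so invertibility of
  -- `dψ` and of `S` need not be established separately.
  have hequiv : ∀ z, (∀ u v, Ω (g z) ![fderiv ℝ g z u, fderiv ℝ g z v] =
        ∑ i : Fin n, (dx i u * dy i v - dx i v * dy i u)) →
      ∃ L : Phase n ≃L[ℝ] (Phase n), (L : Phase n →L[ℝ] (Phase n)) = fderiv ℝ g z := fun z hz => by
    have hinj : Function.Injective (fderiv ℝ g z).toLinearMap := by
      refine (injective_iff_map_eq_zero _).2 fun u hu => ?_
      by_contra hne
      obtain ⟨v, hv⟩ := standardForm_nondegenerate hne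
      rw [← hz u v, ← toBilinL_apply] at hv
      refine hv ?_
      have hu' : fderiv ℝ g z u = 0 := hu
      rw [hu', map_zero]
      rfl
    exact ⟨(LinearEquiv.ofInjectiveEndo _ hinj).toContinuousLinearEquiv, by ext v; rfl⟩
  obtain ⟨O, hgO, hO, h0O⟩ := eventually_nhds_iff.1 hgood
  obtain ⟨L, hL⟩ := hequiv 0 (hgO 0 h0O).2.2
  have hg0 : ContDiffAt ℝ ∞ g 0 := (hgO 0 h0O).2.1
  have hg0' : HasFDerivAt g (L : Phase n →L[ℝ] (Phase n)) 0 := by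
    rw [hL]
    exact (hg0.differentiableAt (by simp)).hasFDerivAt
  -- Restricting to `O` makes the smoothness and pullback identities hold on the whole source.
  let G := (hg0.toOpenPartialHomeomorph g hg0' (by simp)).restrOpen O hO
  have hG : (G : Phase n → (Phase n)) = g := rfl
  refine ⟨G, ⟨hg0.mem_toOpenPartialHomeomorph_source hg0' (by simp), h0O⟩, ?_, fun z hz => ?_⟩
  · simp [hG, g, hψ0]
  · obtain ⟨h1, h2, h3⟩ := hgO z hz.2
    refine ⟨h1, h2, ?_, h3⟩
    obtain ⟨L, hL⟩ := hequiv z h3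
    refine G.contDiffAt_symm (f₀' := L) (G.map_source hz) ?_ ?_
    · rw [G.left_inv hz, hL]
      exact (h2.differentiableAt (by simp)).hasFDerivAt
    · rw [G.left_inv hz]
      exact h2

theorem FormField.inChart_apply {n : ℕ} {M : Type*} [TopologicalSpace M]
    [ChartedSpace (Phase n) M] (σ : FormField (Phase n) M 2) (e : OpenPartialHomeomorph M (Phase n))
    (y u v : Phase n) :
    σ.inChart e y ![u, v] = σ (e.symm y) ![mfderiv (𝓡 (2 * n)) (𝓡 (2 * n)) e.symm y u,
      mfderiv (𝓡 (2 * n)) (𝓡 (2 * n)) e.symm y v] := by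
  refine congrArg (σ (e.symm y)) (funext fun i => ?_)
  fin_cases i <;> rfl

theorem IsSymplecticForm.exists_inChart_ne_zero {n : ℕ} {M : Type*} [TopologicalSpace M]
    [ChartedSpace (Phase n) M] [IsManifold (𝓡 (2 * n)) 1 M] {σ : FormField (Phase n) M 2}
    (hσ : IsSymplecticForm σ) {e : OpenPartialHomeomorph M (Phase n)} (he : e ∈ atlas (Phase n) M)
    {y : Phase n} (hy : y ∈ e.target) {v : Phase n} (hv : v ≠ 0) :
    ∃ w : Phase n, σ.inChart e y ![v, w] ≠ 0 := by
  have hem := (mdifferentiable_of_mem_atlas (I := 𝓡 (2 * n)) he).symm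
  have hne : mfderiv (𝓡 (2 * n)) (𝓡 (2 * n)) e.symm y v ≠ 0 := fun h =>
    hv (hem.mfderiv_injective hy (h.trans (map_zero _).symm))
  obtain ⟨w', hw'⟩ := hσ.nondegenerate _ _ hne
  obtain ⟨w, rfl⟩ := hem.mfderiv_surjective hy w'
  exact ⟨w, fun h => hw' ((FormField.inChart_apply σ e y v w).symm.trans h)⟩

/-- The chain rule makes `dφ` a left inverse of `A = d(e.symm ∘ g)`. In equal finite dimensions `A`
is then onto, so comparing the forms on vectors `A u`, where `hpull` applies, is enough. -/
theorem pullback_standardForm_eq {n : ℕ} {M : Type*} [TopologicalSpace M]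
    [ChartedSpace (Phase n) M] (σ : FormField (Phase n) M 2) {e : OpenPartialHomeomorph M (Phase n)}
    {φ : M → Phase n} {g : Phase n → Phase n} {z : Phase n}
    (hφ : MDifferentiableAt (𝓡 (2 * n)) (𝓡 (2 * n)) φ (e.symm (g z)))
    (he : MDifferentiableAt (𝓡 (2 * n)) (𝓡 (2 * n)) e.symm (g z))
    (hg : DifferentiableAt ℝ g z) (hid : (fun z => φ (e.symm (g z))) =ᶠ[𝓝 z] id)
    (hpull : ∀ u v : Phase n, σ.inChart e (g z) ![fderiv ℝ g z u, fderiv ℝ g z v] =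
      ∑ i : Fin n, (dx i u * dy i v - dx i v * dy i u)) :
    FormField.pullback (E := Phase n) (M := M) φ (standardForm n) (e.symm (g z)) =
      σ (e.symm (g z)) := by
  let D : Phase n →L[ℝ] Phase n := mfderiv (𝓡 (2 * n)) (𝓡 (2 * n)) φ (e.symm (g z))
  let A : Phase n →L[ℝ] Phase n :=
    (show Phase n →L[ℝ] Phase n from mfderiv (𝓡 (2 * n)) (𝓡 (2 * n)) e.symm (g z)) ∘L fderiv ℝ g z
  have hDA (u : Phase n) : D (A u) = u := by
    have h1 := hφ.hasMFDerivAt.comp z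
      (he.hasMFDerivAt.comp z hg.hasFDerivAt.hasMFDerivAt)
    have h2 := hasMFDerivAt_unique h1
      ((hasMFDerivAt_id (I := 𝓡 (2 * n)) z).congr_of_eventuallyEq hid)
    exact DFunLike.congr_fun h2 u
  have hsurj : Function.Surjective A :=
    (LinearMap.injective_iff_surjective (f := A.toLinearMap)).1
      (Function.LeftInverse.injective hDA)
  refine ContinuousAlternatingMap.ext fun v => ?_
  obtain ⟨u₀, hu₀⟩ := hsurj (v 0)
  obtain ⟨u₁, hu₁⟩ := hsurj (v 1)
  have h := hpull u₀ u₁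
  rw [FormField.inChart_apply] at h
  have hv : v = ![A u₀, A u₁] := by
    funext i
    fin_cases i
    · exact hu₀.symm
    · exact hu₁.symm
  have hstd := standardForm_apply n (φ (e.symm (g z))) u₀ u₁
  rw [hv]
  refine Eq.trans ?_ (hstd.trans h.symm)
  refine congrArg (standardForm n (φ (e.symm (g z)))) (funext fun i => ?_)
  fin_cases i
  · exact hDA u₀
  · exact hDA u₁

end Symplectic

theorem theorem1p1 (n : ℕ) (M : Type*) [TopologicalSpace M]
    [ChartedSpace (EuclideanSpace ℝ (Fin (2 * n))) M]
    [IsManifold (𝓡 (2 * n)) ∞ M]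
    (σ : Symplectic.FormField (EuclideanSpace ℝ (Fin (2 * n))) M 2)
    (hσ : Symplectic.IsSymplecticForm σ) (p : M) :
    ∃ φ : OpenPartialHomeomorph M (EuclideanSpace ℝ (Fin (2 * n))),
      p ∈ φ.source ∧ φ p = 0 ∧
        Symplectic.IsSymplectomorphism σ (Symplectic.standardForm n) φ := by
  have : IsManifold (𝓡 (2 * n)) 1 M := IsManifold.of_le (n := ∞) (by simp)
  obtain ⟨e, he, hpe⟩ : ∃ e ∈ atlas (EuclideanSpace ℝ (Fin (2 * n))) M, p ∈ e.source :=
    ⟨chartAt _ p, chart_mem_atlas _ p, mem_chart_source _ p⟩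
  have hemax : e ∈ IsManifold.maximalAtlas (𝓡 (2 * n)) ∞ M :=
    IsManifold.subset_maximalAtlas he
  obtain ⟨G, hG0, hGp, hG⟩ := Symplectic.exists_darboux_coordinates e.open_target
    (hσ.smooth e he) (hσ.closed e he) (e.map_source hpe)
    (fun v hv => hσ.exists_inChart_ne_zero he (e.map_source hpe) hv)
  -- `G` goes from the standard space into the chart, so the Darboux chart uses its inverse.
  let φ := e.trans G.symm
  have hφ : ∀ x ∈ φ.source, ContMDiffAt (𝓡 (2 * n)) (𝓡 (2 * n)) ∞ φ x := fun x hx => by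
    have hx' := hx
    rw [OpenPartialHomeomorph.trans_source] at hx'
    have h := (hG _ (G.map_target hx'.2)).2.2.1
    rw [G.right_inv hx'.2] at h
    exact ContMDiffAt.comp (g := G.symm) (f := e) x h.contMDiffAt
      (contMDiffAt_of_mem_maximalAtlas hemax hx'.1)
  refine ⟨φ, ⟨hpe, ?_⟩, ?_, fun x hx => (hφ x hx).contMDiffWithinAt, fun z hz => ?_, fun x hx => ?_⟩
  · have h := G.map_source hG0
    rwa [hGp] at h
  · exact (congrArg G.symm hGp.symm).trans (G.left_inv hG0)
  · have hz' := hz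
    rw [OpenPartialHomeomorph.trans_target] at hz'
    exact (ContMDiffAt.comp (g := e.symm) z (contMDiffAt_symm_of_mem_maximalAtlas hemax hz'.2)
      (hG z hz'.1).2.1.contMDiffAt).contMDiffWithinAt
  · have hz : φ x ∈ φ.target := φ.map_source hx
    have hz' := hz
    rw [OpenPartialHomeomorph.trans_target] at hz'
    have hxz : e.symm (G (φ x)) = x := φ.left_inv hx
    obtain ⟨h1, h2, -, h4⟩ := hG (φ x) hz'.1
    have key := Symplectic.pullback_standardForm_eq σ (φ := φ) (g := G) (z := φ x)
      (by rw [hxz]; exact (hφ x hx).mdifferentiableAt (by simp))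
      ((contMDiffAt_symm_of_mem_maximalAtlas hemax h1).mdifferentiableAt (by simp))
      (h2.differentiableAt (by simp))
      (by
        filter_upwards [φ.open_target.mem_nhds hz] with y hy
        exact φ.right_inv hy) h4
    rwa [hxz] at key
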